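/- Let $d$ be a nonnegative integer, $\nu>0$ and $l_S>0$. For real $\alpha$ and $z>0$ let $K_\alpha(z)=\int_0^\infty e^{-z\cosh t}\cosh(\alpha t)\,dt$ be the modified Bessel function of the second kind of order $\alpha$. Let $k_S:\mathbb{R}^d\to\mathbb{R}$ be the Matérn covariance function with smoothness $\nu$ and lengthscale $l_S$, $$k_S(x)=\frac{2^{1-\nu}}{\Gamma(\nu)}\left(\frac{\sqrt{2\nu}\,\|x\|_2}{l_S}\right)^{\nu}K_\nu\!\left(\frac{\sqrt{2\nu}\,\|x\|_2}{l_S}\right)\quad(x\neq 0),\qquad k_S(0)=1.$$ Then the convolution integral $(k_S*k_S)(x)=\int_{\mathbb{R}^d}k_S(y)\,k_S(x-y)\,dy$ (with respect to Lebesgue measure) converges absolutely for every $x\in\mathbb{R}^d$, and for every $x\neq 0$ $$(k_S*k_S)(x)=\frac{2^{\frac d2-2\nu+1}\,\pi^{\frac d2}\,\Gamma(\nu+\frac d2)^2}{\Gamma(\nu)^2\,\Gamma(2\nu+d)}\left(\frac{\sqrt{2\nu}}{l_S}\right)^{2\nu-\frac d2}\|x\|_2^{2\nu+\frac d2}\,K_{2\nu+\frac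 d2}\!\left(\frac{\|x\|_2\sqrt{2\nu}}{l_S}\right).$$ The formula also holds at $x=0$ when its right-hand side, which is there of the form $0\cdot\infty$, is replaced by its limit as $\|x\|_2=r\to0^+$ (the right-hand side being regarded as a function of $r>0$). -/

import Mathlib

noncomputable section

/-- The modified Bessel function of the second kind `K_α(z)` of real order `α`, for `z > 0`,
given by `K_α(z) = ∫_0^∞ exp (-z cosh t) cosh (α t) dt`. -/
def besselK (α z : ℝ) : ℝ :=
  ∫ t in Set.Ioi (0 : ℝ), Real.exp (-z * Real.cosh t) * Real.cosh (α * t)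

/-- The Matérn covariance function on `ℝ^d` with smoothness `ν` and lengthscale `l`.
The formula is an indeterminate product `0 * ∞` at the origin, where the kernel takes the value `1`,
the limit of the formula. -/
def maternKernel (d : ℕ) (ν l : ℝ) (x : EuclideanSpace ℝ (Fin d)) : ℝ :=
  open Classical in
  if x = 0 then 1
  else (2 : ℝ) ^ (1 - ν) / Real.Gamma ν * (√(2 * ν) * ‖x‖ / l) ^ ν
    * besselK ν (√(2 * ν) * ‖x‖ / l)

/-- The claimed closed form for the self-convolution, as a function of the radius `r > 0`. -/
def maternConvFormula (d : ℕ) (ν l r : ℝ) : ℝ :=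
  (2 : ℝ) ^ ((d : ℝ) / 2 - 2 * ν + 1) * Real.pi ^ ((d : ℝ) / 2)
      * Real.Gamma (ν + (d : ℝ) / 2) ^ 2
      / (Real.Gamma ν ^ 2 * Real.Gamma (2 * ν + (d : ℝ)))
    * (√(2 * ν) / l) ^ (2 * ν - (d : ℝ) / 2)
    * r ^ (2 * ν + (d : ℝ) / 2)
    * besselK (2 * ν + (d : ℝ) / 2) (r * √(2 * ν) / l)

end

open scoped Convolution

open MeasureTheory Set

/-! The substitution `s = (z/2) e^u` turns the damped Gamma integral into `z^a K_a(z)`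
(`rpow_mul_besselK`). Hence the Matérn kernel is a Gamma mixture, over `s > 0`, of the Gaussians
`exp (-c‖x‖²/s)` with `c = (√(2ν)/l)²/4`.

Convolving the Gaussians of parameters `s` and `t` gives the one of parameter `s + t`, times
`(π/c)^(d/2) (st/(s+t))^(d/2)`. Apart from powers of `s` and of `t`, the mixed integrand then
depends on `s + t` alone. Dirichlet's formula integrates out the proportion `s/(s+t)`, which
produces the Beta factor, and leaves a damped Gamma integral of order `2ν + d/2`: this is the Bessel
function of the claim (`integral_dampedGamma_mul`).

Everything is nonnegative, so Tonelli also yields absolute convergence. Damped Gamma integrals are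
finite and right-continuous at `q = 0`, which settles the origin. -/

/-- The integrand of the Gamma integral `Γ(a)`, damped near the origin by `exp (-q / s)`. -/
noncomputable def dampedGammaIntegrand (a q s : ℝ) : ℝ :=
  s ^ (a - 1) * Real.exp (-s) * Real.exp (-q / s)

/-- The Gamma integral damped near the origin by `exp (-q / s)`. -/
noncomputable def dampedGamma (a q : ℝ) : ℝ :=
  ∫ s in Ioi (0 : ℝ), dampedGammaIntegrand a q s

/-! ### Damped Gamma integrals -/

lemma measurable_dampedGammaIntegrand (a : ℝ) :
    Measurable fun p : ℝ × ℝ => dampedGammaIntegrand a p.1 p.2 := by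
  unfold dampedGammaIntegrand
  fun_prop

lemma integrableOn_gammaIntegrand {a : ℝ} (ha : 0 < a) :
    IntegrableOn (fun s : ℝ => s ^ (a - 1) * Real.exp (-s)) (Ioi 0) := by
  simpa only [mul_comm] using Real.GammaIntegral_convergent ha

lemma integral_gammaIntegrand {a : ℝ} (ha : 0 < a) :
    ∫ s in Ioi (0 : ℝ), s ^ (a - 1) * Real.exp (-s) = Real.Gamma a := by
  rw [Real.Gamma_eq_integral ha]
  simp only [mul_comm]

lemma dampedGammaIntegrand_nonneg (a q : ℝ) {s : ℝ} (hs : 0 < s) :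
    0 ≤ dampedGammaIntegrand a q s := by
  unfold dampedGammaIntegrand
  positivity

lemma dampedGammaIntegrand_le (a : ℝ) {q s : ℝ} (hq : 0 ≤ q) (hs : 0 < s) :
    dampedGammaIntegrand a q s ≤ s ^ (a - 1) * Real.exp (-s) := by
  unfold dampedGammaIntegrand
  refine mul_le_of_le_one_right (by positivity) (Real.exp_le_one_iff.2 ?_)
  rw [neg_div]
  exact neg_nonpos.2 (by positivity)

lemma integrableOn_dampedGammaIntegrand {a q : ℝ} (ha : 0 < a) (hq : 0 ≤ q) :
    IntegrableOn (dampedGammaIntegrand a q) (Ioi 0) := by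
  refine (integrableOn_gammaIntegrand ha).mono'
    ((measurable_dampedGammaIntegrand a).comp measurable_prodMk_left).aestronglyMeasurable ?_
  refine (ae_restrict_mem measurableSet_Ioi).mono fun s hs => ?_
  rw [Real.norm_of_nonneg (dampedGammaIntegrand_nonneg a q hs)]
  exact dampedGammaIntegrand_le a hq hs

lemma dampedGamma_zero {a : ℝ} (ha : 0 < a) : dampedGamma a 0 = Real.Gamma a := by
  simp [dampedGamma, dampedGammaIntegrand, integral_gammaIntegrand ha]

lemma tendsto_dampedGamma_zero {a : ℝ} (ha : 0 < a) :
    Filter.Tendsto (dampedGamma a) (nhdsWithin 0 (Ici 0)) (nhds (dampedGamma a 0)) := by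
  refine tendsto_integral_filter_of_dominated_convergence
    (fun s : ℝ => s ^ (a - 1) * Real.exp (-s)) ?_ ?_ (integrableOn_gammaIntegrand ha) ?_
  · exact .of_forall fun q =>
      ((measurable_dampedGammaIntegrand a).comp measurable_prodMk_left).aestronglyMeasurable
  · refine eventually_mem_nhdsWithin.mono fun q hq => ?_
    refine (ae_restrict_mem measurableSet_Ioi).mono fun s hs => ?_
    rw [Real.norm_of_nonneg (dampedGammaIntegrand_nonneg a q hs)]
    exact dampedGammaIntegrand_le a hq hs
  · refine .of_forall fun s => ?_
    have : Continuous fun q => dampedGammaIntegrand a q s := by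
      unfold dampedGammaIntegrand
      fun_prop
    exact (this.tendsto 0).mono_left nhdsWithin_le_nhds

/-! ### Bessel functions as damped Gamma integrals -/

lemma integral_eq_integral_Ioi_add_comp_neg {f : ℝ → ℝ} (hf : Integrable f) :
    ∫ u, f u = ∫ u in Ioi (0 : ℝ), (f u + f (-u)) := by
  rw [integral_add hf.integrableOn hf.comp_neg.integrableOn,
    ← intervalIntegral.integral_Iic_add_Ioi hf.integrableOn hf.integrableOn (b := 0), add_comm,
    ← neg_zero (G := ℝ), ← integral_comp_neg_Iic 0 fun u => f (-u)]
  simp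

/-- The Gamma mixture representation of the modified Bessel function of the second kind. -/
theorem rpow_mul_besselK {a z : ℝ} (ha : 0 < a) (hz : 0 < z) :
    z ^ a * besselK a z = 2 ^ (a - 1) * dampedGamma a (z ^ 2 / 4) := by
  -- The scale `z / 2` symmetrizes the exponent: for `s = (z/2) e^u`, `s + z²/(4s) = z cosh u`.
  have hderiv : ∀ u ∈ (univ : Set ℝ),
      HasDerivWithinAt (fun u => z / 2 * Real.exp u) (z / 2 * Real.exp u) univ u :=
    fun u _ => ((Real.hasDerivAt_exp u).const_mul _).hasDerivWithinAt
  have hinj : InjOn (fun u => z / 2 * Real.exp u) univ := fun u _ v _ h => by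
    simpa [hz.ne'] using h
  have himage : (fun u => z / 2 * Real.exp u) '' univ = Ioi 0 := by
    ext s
    simp only [image_univ, mem_range, mem_Ioi]
    constructor
    · rintro ⟨u, rfl⟩
      positivity
    · intro hs
      refine ⟨Real.log (s / (z / 2)), ?_⟩
      rw [Real.exp_log (by positivity)]
      field_simp
  have hpull : ∀ u, |z / 2 * Real.exp u| •
      dampedGammaIntegrand a (z ^ 2 / 4) (z / 2 * Real.exp u)
        = (z / 2) ^ a * (Real.exp (a * u) * Real.exp (-z * Real.cosh u)) := by
    intro u
    have hs : 0 < z / 2 * Real.exp u := by positivity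
    have hpow : z / 2 * Real.exp u * (z / 2 * Real.exp u) ^ (a - 1)
        = (z / 2) ^ a * Real.exp (a * u) := by
      rw [mul_comm, ← Real.rpow_add_one hs.ne', sub_add_cancel,
        Real.mul_rpow (by positivity) (by positivity), ← Real.exp_mul, mul_comm u]
    have hexp : Real.exp (-(z / 2 * Real.exp u)) *
        Real.exp (-(z ^ 2 / 4) / (z / 2 * Real.exp u)) = Real.exp (-z * Real.cosh u) := by
      rw [← Real.exp_add, Real.cosh_eq, Real.exp_neg]
      congr 1
      field_simp
      ring
    rw [abs_of_pos hs, smul_eq_mul, dampedGammaIntegrand, mul_assoc (_ ^ _), hexp,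
      ← mul_assoc, hpow, mul_assoc]
  have hint : Integrable fun u => Real.exp (a * u) * Real.exp (-z * Real.cosh u) := by
    have h := integrableOn_dampedGammaIntegrand ha (q := z ^ 2 / 4) (by positivity)
    rw [← himage, integrableOn_image_iff_integrableOn_abs_deriv_smul MeasurableSet.univ hderiv hinj]
      at h
    simp only [hpull, integrableOn_univ] at h
    simpa using (integrable_const_mul_iff
      (isUnit_iff_ne_zero.2 (Real.rpow_pos_of_pos (half_pos hz) a).ne') _).1 h
  have hfold : dampedGamma a (z ^ 2 / 4) = (z / 2) ^ a * (2 * besselK a z) := by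
    rw [dampedGamma, ← himage,
      integral_image_eq_integral_abs_deriv_smul MeasurableSet.univ hderiv hinj]
    simp only [hpull, Measure.restrict_univ]
    -- Folding at `0` pairs `e^(au)` with `e^(-au)`, since `cosh u` is even.
    rw [integral_const_mul, integral_eq_integral_Ioi_add_comp_neg hint, besselK,
      ← integral_const_mul 2]
    congr 2
    ext u
    rw [Real.cosh_neg, Real.cosh_eq (a * u), mul_neg]
    ring
  rw [hfold, Real.div_rpow hz.le zero_le_two, Real.rpow_sub_one two_ne_zero]
  field_simp

/-! ### Products of Gaussians -/

/-- Completing the square in `y`. -/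
lemma exp_neg_mul_sq_mul_exp_neg_mul_sq {E : Type*} [NormedAddCommGroup E]
    [InnerProductSpace ℝ E] {a b : ℝ} (hab : a + b ≠ 0) (x y : E) :
    Real.exp (-a * ‖y‖ ^ 2) * Real.exp (-b * ‖x - y‖ ^ 2)
      = Real.exp (-(a * b / (a + b)) * ‖x‖ ^ 2)
        * Real.exp (-(a + b) * ‖y - (b / (a + b)) • x‖ ^ 2) := by
  rw [← Real.exp_add, ← Real.exp_add, norm_sub_sq_real, norm_sub_sq_real, norm_smul, mul_pow,
    inner_smul_right, Real.norm_eq_abs, sq_abs, real_inner_comm]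
  congr 1
  field_simp
  ring

section Gaussian

variable {E : Type*} [NormedAddCommGroup E] [InnerProductSpace ℝ E] [FiniteDimensional ℝ E]
  [MeasurableSpace E] [BorelSpace E]

lemma integrable_exp_neg_mul_sq_norm {b : ℝ} (hb : 0 < b) :
    Integrable fun v : E => Real.exp (-b * ‖v‖ ^ 2) := by
  -- A non-integrable function has integral `0` by convention, but the known Gaussian value is
  -- positive.
  by_contra h
  have := GaussianFourier.integral_rexp_neg_mul_sq_norm (V := E) hb
  rw [integral_undef h] at this
  exact (Real.rpow_pos_of_pos (div_pos Real.pi_pos hb) _).ne this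

lemma integrable_gaussian_mul_gaussian {a b : ℝ} (ha : 0 < a) (hb : 0 < b) (x : E) :
    Integrable fun y : E => Real.exp (-a * ‖y‖ ^ 2) * Real.exp (-b * ‖x - y‖ ^ 2) := by
  simp only [exp_neg_mul_sq_mul_exp_neg_mul_sq (add_pos ha hb).ne']
  exact ((integrable_exp_neg_mul_sq_norm (add_pos ha hb)).comp_sub_right _).const_mul _

/-- The convolution of two centred Gaussians. -/
lemma integral_gaussian_mul_gaussian {a b : ℝ} (ha : 0 < a) (hb : 0 < b) (x : E) :
    ∫ y : E, Real.exp (-a * ‖y‖ ^ 2) * Real.exp (-b * ‖x - y‖ ^ 2)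
      = (Real.pi / (a + b)) ^ (Module.finrank ℝ E / 2 : ℝ)
        * Real.exp (-(a * b / (a + b)) * ‖x‖ ^ 2) := by
  simp only [exp_neg_mul_sq_mul_exp_neg_mul_sq (add_pos ha hb).ne']
  rw [integral_const_mul,
    integral_sub_right_eq_self (fun y : E => Real.exp (-(a + b) * ‖y‖ ^ 2)),
    GaussianFourier.integral_rexp_neg_mul_sq_norm (add_pos ha hb), mul_comm]

end Gaussian

/-! ### Beta integral and Dirichlet's formula -/

/-- The Beta integral over `(0, u)`. -/
lemma integral_rpow_mul_sub_rpow {p q u : ℝ} (hp : 0 < p) (hq : 0 < q) (hu : 0 < u) :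
    ∫ s in (0 : ℝ)..u, s ^ (p - 1) * (u - s) ^ (q - 1)
      = u ^ (p + q - 1) * ProbabilityTheory.beta p q := by
  have h := Complex.betaIntegral_scaled p q hu
  rw [Complex.betaIntegral_eq_Gamma_mul_div _ _ (by simpa) (by simpa)] at h
  rw [← Complex.ofReal_inj, ← intervalIntegral.integral_ofReal, ProbabilityTheory.beta]
  push_cast
  rw [Complex.ofReal_cpow hu.le, ← Complex.Gamma_ofReal, ← Complex.Gamma_ofReal,
    ← Complex.Gamma_ofReal]
  push_cast
  rw [← h]
  refine intervalIntegral.integral_congr fun s hs => ?_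
  rw [uIcc_of_le hu.le] at hs
  rw [Complex.ofReal_cpow hs.1, Complex.ofReal_cpow (sub_nonneg.2 hs.2)]
  push_cast
  rfl

/-- Dirichlet's formula, reducing a double integral over the quadrant to a single one. -/
theorem integral_rpow_mul_rpow_mul_comp_add {p q : ℝ} (hp : 0 < p) (hq : 0 < q) {g : ℝ → ℝ}
    (hint : Integrable (fun z : ℝ × ℝ => z.1 ^ (p - 1) * z.2 ^ (q - 1) * g (z.1 + z.2))
      ((volume.restrict (Ioi 0)).prod (volume.restrict (Ioi 0)))) :
    ∫ z : ℝ × ℝ, z.1 ^ (p - 1) * z.2 ^ (q - 1) * g (z.1 + z.2)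
        ∂(volume.restrict (Ioi 0)).prod (volume.restrict (Ioi 0))
      = ProbabilityTheory.beta p q * ∫ u in Ioi (0 : ℝ), u ^ (p + q - 1) * g u := by
  set F : ℝ × ℝ → ℝ := fun z => z.1 ^ (p - 1) * z.2 ^ (q - 1) * g (z.1 + z.2) with hF
  -- `G` is `F` extended by zero off the quadrant, in the coordinates `(s, u) = (s, s + t)`; this
  -- shear preserves Lebesgue measure.
  set G : ℝ × ℝ → ℝ := fun z => (Ioi (0 : ℝ) ×ˢ Ioi (0 : ℝ)).indicator F (z.1, z.2 - z.1) with hG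
  have hS : MeasurableSet (Ioi (0 : ℝ) ×ˢ Ioi (0 : ℝ)) := measurableSet_Ioi.prod measurableSet_Ioi
  have hT : MeasurePreserving (MeasurableEquiv.shearAddRight ℝ) (volume.prod volume)
      (volume.prod volume) := measurePreserving_prod_add volume volume
  have hGT : G ∘ MeasurableEquiv.shearAddRight ℝ
      = (Ioi (0 : ℝ) ×ˢ Ioi (0 : ℝ)).indicator F := by
    ext z
    simp [hG, MeasurableEquiv.shearAddRight]
  rw [Measure.prod_restrict] at hint ⊢
  have hGint : Integrable G (volume.prod volume) := by
    rw [← hT.integrable_comp_emb (MeasurableEquiv.measurableEmbedding _), hGT,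
      integrable_indicator_iff hS]
    exact hint
  rw [← integral_indicator hS, ← hGT]
  simp only [Function.comp_def]
  rw [hT.integral_comp (MeasurableEquiv.measurableEmbedding _), integral_prod_symm _ hGint,
    ← integral_const_mul, ← integral_indicator measurableSet_Ioi]
  congr 1
  ext u
  have hinner : (fun s => G (s, u))
      = (Ioo 0 u).indicator fun s => s ^ (p - 1) * (u - s) ^ (q - 1) * g u := by
    ext s
    simp only [hG, hF, indicator, mem_prod, mem_Ioi, sub_pos, mem_Ioo, add_sub_cancel]
  rw [hinner, integral_indicator measurableSet_Ioo]
  by_cases hu : 0 < u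
  · rw [indicator_of_mem (show u ∈ Ioi 0 from hu), integral_mul_const, ← integral_Ioc_eq_integral_Ioo,
      ← intervalIntegral.integral_of_le hu.le, integral_rpow_mul_sub_rpow hp hq hu]
    ring
  · rw [indicator_of_notMem (show u ∉ Ioi 0 from hu), Ioo_eq_empty hu]
    simp

/-! ### Convolution of Gamma mixtures -/

/-- The radial factor of `integral_dampedGammaIntegrand_mul` in the variable `u = s + t`. -/
noncomputable def mixtureRadialFactor (m q u : ℝ) : ℝ :=
  u ^ (-m) * Real.exp (-u) * Real.exp (-q / u)

/-- Since `(t/(s+t))^m ≤ 1`, the factor `(s+t)^(-m)` absorbs `t^m`, and a product of Gamma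
integrands of orders `a + m` and `b` dominates. -/
lemma integrable_rpow_mul_rpow_mul_mixtureRadialFactor {a b m q : ℝ} (ha : 0 < a) (hb : 0 < b)
    (hm : 0 ≤ m) (hq : 0 ≤ q) :
    Integrable (fun z : ℝ × ℝ =>
        z.1 ^ (a + m - 1) * z.2 ^ (b + m - 1) * mixtureRadialFactor m q (z.1 + z.2))
      ((volume.restrict (Ioi 0)).prod (volume.restrict (Ioi 0))) := by
  refine ((integrableOn_gammaIntegrand (add_pos_of_pos_of_nonneg ha hm)).mul_prod
    (integrableOn_gammaIntegrand hb)).mono' ?_ ?_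
  · unfold mixtureRadialFactor
    exact Measurable.aestronglyMeasurable (by fun_prop)
  · rw [Measure.prod_restrict]
    refine (ae_restrict_mem (measurableSet_Ioi.prod measurableSet_Ioi)).mono ?_
    rintro ⟨s, t⟩ ⟨hs : 0 < s, ht : 0 < t⟩
    have hst : 0 < s + t := add_pos hs ht
    have hexp : Real.exp (-q / (s + t)) ≤ 1 := by
      rw [Real.exp_le_one_iff, neg_div]
      exact neg_nonpos.2 (by positivity)
    have hpow : t ^ m * (s + t) ^ (-m) ≤ 1 := by
      rw [Real.rpow_neg hst.le, ← div_eq_mul_inv, ← Real.div_rpow ht.le hst.le]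
      exact Real.rpow_le_one (by positivity) ((div_le_one hst).2 (by linarith)) hm
    unfold mixtureRadialFactor
    rw [Real.norm_of_nonneg (by positivity)]
    calc s ^ (a + m - 1) * t ^ (b + m - 1)
          * ((s + t) ^ (-m) * Real.exp (-(s + t)) * Real.exp (-q / (s + t)))
        = s ^ (a + m - 1) * Real.exp (-s) * (t ^ (b - 1) * Real.exp (-t))
          * ((t ^ m * (s + t) ^ (-m)) * Real.exp (-q / (s + t))) := by
          rw [show b + m - 1 = b - 1 + m by ring, Real.rpow_add ht, neg_add, Real.exp_add]
          ring
      _ ≤ s ^ (a + m - 1) * Real.exp (-s) * (t ^ (b - 1) * Real.exp (-t)) * 1 :=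
          mul_le_mul_of_nonneg_left (mul_le_one₀ hpow (by positivity) hexp) (by positivity)
      _ = _ := mul_one _

lemma dampedGammaIntegrand_mul_eq {E : Type*} [NormedAddCommGroup E] {a b c s t : ℝ} (x y : E) :
    dampedGammaIntegrand a (c * ‖y‖ ^ 2) s * dampedGammaIntegrand b (c * ‖x - y‖ ^ 2) t
      = s ^ (a - 1) * Real.exp (-s) * (t ^ (b - 1) * Real.exp (-t))
        * (Real.exp (-(c / s) * ‖y‖ ^ 2) * Real.exp (-(c / t) * ‖x - y‖ ^ 2)) := by
  unfold dampedGammaIntegrand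
  rw [show -(c * ‖y‖ ^ 2) / s = -(c / s) * ‖y‖ ^ 2 by ring,
    show -(c * ‖x - y‖ ^ 2) / t = -(c / t) * ‖x - y‖ ^ 2 by ring]
  ring

section Convolution

variable {E : Type*} [NormedAddCommGroup E] [InnerProductSpace ℝ E] [FiniteDimensional ℝ E]
  [MeasurableSpace E] [BorelSpace E]

lemma integral_dampedGammaIntegrand_mul {a b c s t : ℝ} (hc : 0 < c) (hs : 0 < s) (ht : 0 < t)
    (x : E) :
    ∫ y : E, dampedGammaIntegrand a (c * ‖y‖ ^ 2) s * dampedGammaIntegrand b (c * ‖x - y‖ ^ 2) t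
      = (Real.pi / c) ^ (Module.finrank ℝ E / 2 : ℝ)
        * (s ^ (a + Module.finrank ℝ E / 2 - 1) * t ^ (b + Module.finrank ℝ E / 2 - 1)
          * mixtureRadialFactor (Module.finrank ℝ E / 2) (c * ‖x‖ ^ 2) (s + t)) := by
  simp only [dampedGammaIntegrand_mul_eq]
  rw [integral_const_mul,
    integral_gaussian_mul_gaussian (div_pos hc hs) (div_pos hc ht)]
  set m : ℝ := Module.finrank ℝ E / 2
  have hst : 0 < s + t := add_pos hs ht
  have hpow : (Real.pi / (c / s + c / t)) ^ m
      = (Real.pi / c) ^ m * (s ^ m * t ^ m * (s + t) ^ (-m)) := by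
    rw [show Real.pi / (c / s + c / t) = Real.pi / c * (s * t * (s + t)⁻¹) by
        field_simp
        ring,
      Real.mul_rpow (div_pos Real.pi_pos hc).le (by positivity),
      Real.mul_rpow (by positivity) (by positivity), Real.mul_rpow hs.le ht.le,
      Real.inv_rpow hst.le, Real.rpow_neg hst.le]
  have hexp : -(c / s * (c / t) / (c / s + c / t)) * ‖x‖ ^ 2 = -(c * ‖x‖ ^ 2) / (s + t) := by
    field_simp
    ring
  rw [hpow, hexp, show a + m - 1 = a - 1 + m by ring, show b + m - 1 = b - 1 + m by ring,
    Real.rpow_add hs, Real.rpow_add ht, mixtureRadialFactor, neg_add s t, Real.exp_add]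
  ring

/-- Tonelli with `y` innermost: the Gaussian integral is explicit, and by nonnegativity it is also
the integral of the norm. This justifies the exchange of integrals below. -/
lemma integrable_dampedGammaIntegrand_mul {a b c : ℝ} (ha : 0 < a) (hb : 0 < b) (hc : 0 < c)
    (x : E) :
    Integrable (fun w : E × (ℝ × ℝ) => dampedGammaIntegrand a (c * ‖w.1‖ ^ 2) w.2.1
        * dampedGammaIntegrand b (c * ‖x - w.1‖ ^ 2) w.2.2)
      (volume.prod ((volume.restrict (Ioi 0)).prod (volume.restrict (Ioi 0)))) := by
  have hmeas : Measurable (fun w : E × (ℝ × ℝ) => dampedGammaIntegrand a (c * ‖w.1‖ ^ 2) w.2.1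
      * dampedGammaIntegrand b (c * ‖x - w.1‖ ^ 2) w.2.2) := by
    unfold dampedGammaIntegrand
    fun_prop
  have hmem : ∀ᵐ z : ℝ × ℝ ∂(volume.restrict (Ioi 0)).prod (volume.restrict (Ioi 0)),
      z ∈ Ioi (0 : ℝ) ×ˢ Ioi (0 : ℝ) := by
    rw [Measure.prod_restrict]
    exact ae_restrict_mem (measurableSet_Ioi.prod measurableSet_Ioi)
  rw [integrable_prod_iff' hmeas.aestronglyMeasurable]
  constructor
  · filter_upwards [hmem] with z hz
    simp only [dampedGammaIntegrand_mul_eq]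
    exact (integrable_gaussian_mul_gaussian (div_pos hc hz.1) (div_pos hc hz.2) x).const_mul _
  · refine ((integrable_rpow_mul_rpow_mul_mixtureRadialFactor ha hb
      (m := Module.finrank ℝ E / 2) (q := c * ‖x‖ ^ 2) (by positivity) (by positivity)).const_mul
        ((Real.pi / c) ^ (Module.finrank ℝ E / 2 : ℝ))).congr ?_
    filter_upwards [hmem] with z hz
    rw [← integral_dampedGammaIntegrand_mul hc hz.1 hz.2]
    refine integral_congr_ae (.of_forall fun y => ?_)
    exact (Real.norm_of_nonneg (mul_nonneg (dampedGammaIntegrand_nonneg _ _ hz.1)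
      (dampedGammaIntegrand_nonneg _ _ hz.2))).symm

lemma integrable_dampedGamma_mul {a b c : ℝ} (ha : 0 < a) (hb : 0 < b) (hc : 0 < c) (x : E) :
    Integrable fun y : E => dampedGamma a (c * ‖y‖ ^ 2) * dampedGamma b (c * ‖x - y‖ ^ 2) := by
  refine (integrable_dampedGammaIntegrand_mul ha hb hc x).integral_prod_left.congr
    (.of_forall fun y => ?_)
  exact integral_prod_mul (dampedGammaIntegrand a (c * ‖y‖ ^ 2))
    (dampedGammaIntegrand b (c * ‖x - y‖ ^ 2))

/-- The convolution of two radial Gamma mixtures of Gaussians is again such a mixture. -/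
theorem integral_dampedGamma_mul {a b c : ℝ} (ha : 0 < a) (hb : 0 < b) (hc : 0 < c) (x : E) :
    ∫ y : E, dampedGamma a (c * ‖y‖ ^ 2) * dampedGamma b (c * ‖x - y‖ ^ 2)
      = (Real.pi / c) ^ (Module.finrank ℝ E / 2 : ℝ)
        * ProbabilityTheory.beta (a + Module.finrank ℝ E / 2) (b + Module.finrank ℝ E / 2)
        * dampedGamma (a + b + Module.finrank ℝ E / 2) (c * ‖x‖ ^ 2) := by
  have hm : (0 : ℝ) ≤ Module.finrank ℝ E / 2 := by positivity
  have hint := integrable_rpow_mul_rpow_mul_mixtureRadialFactor ha hb hm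
    (q := c * ‖x‖ ^ 2) (by positivity)
  calc ∫ y : E, dampedGamma a (c * ‖y‖ ^ 2) * dampedGamma b (c * ‖x - y‖ ^ 2)
      = ∫ y : E, ∫ z : ℝ × ℝ, dampedGammaIntegrand a (c * ‖y‖ ^ 2) z.1
          * dampedGammaIntegrand b (c * ‖x - y‖ ^ 2) z.2
          ∂(volume.restrict (Ioi (0 : ℝ))).prod (volume.restrict (Ioi (0 : ℝ))) :=
        integral_congr_ae (.of_forall fun y =>
          (integral_prod_mul (dampedGammaIntegrand a (c * ‖y‖ ^ 2))
            (dampedGammaIntegrand b (c * ‖x - y‖ ^ 2))).symm)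
    _ = ∫ z : ℝ × ℝ, (∫ y : E, dampedGammaIntegrand a (c * ‖y‖ ^ 2) z.1
          * dampedGammaIntegrand b (c * ‖x - y‖ ^ 2) z.2)
          ∂(volume.restrict (Ioi (0 : ℝ))).prod (volume.restrict (Ioi (0 : ℝ))) :=
        integral_integral_swap (integrable_dampedGammaIntegrand_mul ha hb hc x)
    _ = ∫ z : ℝ × ℝ, (Real.pi / c) ^ (Module.finrank ℝ E / 2 : ℝ)
          * (z.1 ^ (a + Module.finrank ℝ E / 2 - 1) * z.2 ^ (b + Module.finrank ℝ E / 2 - 1)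
            * mixtureRadialFactor (Module.finrank ℝ E / 2) (c * ‖x‖ ^ 2) (z.1 + z.2))
          ∂(volume.restrict (Ioi (0 : ℝ))).prod (volume.restrict (Ioi (0 : ℝ))) := by
        rw [Measure.prod_restrict]
        exact setIntegral_congr_fun (measurableSet_Ioi.prod measurableSet_Ioi)
          fun z (hz : 0 < z.1 ∧ 0 < z.2) => integral_dampedGammaIntegrand_mul hc hz.1 hz.2 x
    _ = _ := by
        rw [integral_const_mul, integral_rpow_mul_rpow_mul_comp_add (by positivity)
          (by positivity) hint, mul_assoc, dampedGamma]
        congr 2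
        refine setIntegral_congr_fun measurableSet_Ioi fun u (hu : 0 < u) => ?_
        dsimp only [mixtureRadialFactor, dampedGammaIntegrand]
        rw [← mul_assoc, ← mul_assoc, ← Real.rpow_add hu]
        congr 3
        ring

end Convolution

/-! ### The Matérn kernel and its self-convolution -/

/-- The origin needs no exception here: the undamped integral is `Γ(ν)`, matching the value `1`. -/
theorem maternKernel_eq_dampedGamma {d : ℕ} {ν l : ℝ} (hν : 0 < ν) (hl : 0 < l)
    (x : EuclideanSpace ℝ (Fin d)) :
    maternKernel d ν l x
      = (Real.Gamma ν)⁻¹ * dampedGamma ν ((√(2 * ν) / l) ^ 2 / 4 * ‖x‖ ^ 2) := by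
  unfold maternKernel
  split_ifs with hx
  · rw [hx, norm_zero, zero_pow two_ne_zero, mul_zero, dampedGamma_zero hν,
      inv_mul_cancel₀ (Real.Gamma_pos_of_pos hν).ne']
  · have hx' : 0 < ‖x‖ := norm_pos_iff.2 hx
    rw [mul_assoc, rpow_mul_besselK hν (by positivity),
      show (√(2 * ν) * ‖x‖ / l) ^ 2 / 4 = (√(2 * ν) / l) ^ 2 / 4 * ‖x‖ ^ 2 by ring,
      show (1 : ℝ) - ν = -(ν - 1) by ring, Real.rpow_neg zero_le_two]
    have := (Real.rpow_pos_of_pos (zero_lt_two' ℝ) (ν - 1)).ne'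
    field_simp

theorem maternConvFormula_eq_dampedGamma {d : ℕ} {ν l r : ℝ} (hν : 0 < ν) (hl : 0 < l)
    (hr : 0 < r) :
    maternConvFormula d ν l r
      = (Real.Gamma ν)⁻¹ ^ 2 * ((Real.pi / ((√(2 * ν) / l) ^ 2 / 4)) ^ ((d : ℝ) / 2)
        * ProbabilityTheory.beta (ν + d / 2) (ν + d / 2)
        * dampedGamma (ν + ν + d / 2) ((√(2 * ν) / l) ^ 2 / 4 * r ^ 2)) := by
  have hκ : 0 < √(2 * ν) / l := by positivity
  unfold maternConvFormula
  rw [show r * √(2 * ν) / l = √(2 * ν) / l * r by ring]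
  set κ := √(2 * ν) / l
  have hbessel := rpow_mul_besselK (a := 2 * ν + (d : ℝ) / 2) (z := κ * r) (by positivity) (by positivity)
  have hscale : (2 : ℝ) ^ ((d : ℝ) / 2 - 2 * ν + 1) * Real.pi ^ ((d : ℝ) / 2)
      * κ ^ (2 * ν - (d : ℝ) / 2) * 2 ^ (2 * ν + (d : ℝ) / 2 - 1)
      = (Real.pi / (κ ^ 2 / 4)) ^ ((d : ℝ) / 2) * κ ^ (2 * ν + (d : ℝ) / 2) := by
    rw [show Real.pi / (κ ^ 2 / 4) = 2 ^ (2 : ℝ) * Real.pi * κ ^ (-2 : ℝ) by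
        rw [Real.rpow_neg hκ.le, Real.rpow_two, Real.rpow_two]
        field_simp
        norm_num,
      Real.mul_rpow (by positivity) (by positivity), Real.mul_rpow (by positivity) (by positivity),
      ← Real.rpow_mul zero_le_two, ← Real.rpow_mul hκ.le]
    have h2 : (2 : ℝ) ^ ((d : ℝ) / 2 - 2 * ν + 1) * 2 ^ (2 * ν + (d : ℝ) / 2 - 1)
        = 2 ^ (2 * ((d : ℝ) / 2)) := by
      rw [← Real.rpow_add zero_lt_two]
      congr 1
      ring
    have h3 : κ ^ (2 * ν - (d : ℝ) / 2) = κ ^ (-2 * ((d : ℝ) / 2)) * κ ^ (2 * ν + (d : ℝ) / 2) := by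
      rw [← Real.rpow_add hκ]
      congr 1
      ring
    rw [h3, ← h2]
    ring
  rw [Real.mul_rpow hκ.le hr.le, show (κ * r) ^ 2 / 4 = κ ^ 2 / 4 * r ^ 2 by ring] at hbessel
  have hcancel := (Real.rpow_pos_of_pos hκ (2 * ν + (d : ℝ) / 2)).ne'
  -- Multiplying both sides by `κ^(2ν + d/2)` completes `r^(2ν + d/2)` to the power of `κ r`
  -- required by `hbessel`.
  rw [← mul_right_inj' hcancel, ProbabilityTheory.beta,
    show ν + d / 2 + (ν + d / 2) = 2 * ν + d by ring, show ν + ν + (d : ℝ) / 2 = 2 * ν + d / 2 by ring]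
  calc _ = Real.Gamma (ν + d / 2) ^ 2 / (Real.Gamma ν ^ 2 * Real.Gamma (2 * ν + d))
        * (2 ^ ((d : ℝ) / 2 - 2 * ν + 1) * Real.pi ^ ((d : ℝ) / 2) * κ ^ (2 * ν - (d : ℝ) / 2))
        * (κ ^ (2 * ν + (d : ℝ) / 2) * r ^ (2 * ν + (d : ℝ) / 2)
          * besselK (2 * ν + d / 2) (κ * r)) := by ring
    _ = Real.Gamma (ν + d / 2) ^ 2 / (Real.Gamma ν ^ 2 * Real.Gamma (2 * ν + d))
        * (2 ^ ((d : ℝ) / 2 - 2 * ν + 1) * Real.pi ^ ((d : ℝ) / 2) * κ ^ (2 * ν - (d : ℝ) / 2)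
          * 2 ^ (2 * ν + (d : ℝ) / 2 - 1)) * dampedGamma (2 * ν + d / 2) (κ ^ 2 / 4 * r ^ 2) := by
      rw [hbessel]
      ring
    _ = _ := by
      rw [hscale]
      ring

open scoped Convolution in
theorem maternKernel_convolution_eq_dampedGamma {d : ℕ} {ν l : ℝ} (hν : 0 < ν) (hl : 0 < l)
    (x : EuclideanSpace ℝ (Fin d)) :
    (maternKernel d ν l ⋆[ContinuousLinearMap.mul ℝ ℝ, volume] maternKernel d ν l) x
      = (Real.Gamma ν)⁻¹ ^ 2 * ((Real.pi / ((√(2 * ν) / l) ^ 2 / 4)) ^ ((d : ℝ) / 2)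
        * ProbabilityTheory.beta (ν + d / 2) (ν + d / 2)
        * dampedGamma (ν + ν + d / 2) ((√(2 * ν) / l) ^ 2 / 4 * ‖x‖ ^ 2)) := by
  have h := integral_dampedGamma_mul hν hν (c := (√(2 * ν) / l) ^ 2 / 4) (by positivity) x
  rw [finrank_euclideanSpace_fin] at h
  rw [← h, convolution_def, ← integral_const_mul]
  refine integral_congr_ae (.of_forall fun y => ?_)
  simp only [ContinuousLinearMap.mul_apply', maternKernel_eq_dampedGamma hν hl]
  ring

theorem convolutionExists_maternKernel (d : ℕ) {ν l : ℝ} (hν : 0 < ν) (hl : 0 < l) :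
    ConvolutionExists (maternKernel d ν l) (maternKernel d ν l)
      (ContinuousLinearMap.mul ℝ ℝ) volume := fun x => by
  refine ((integrable_dampedGamma_mul hν hν (c := (√(2 * ν) / l) ^ 2 / 4)
    (by positivity) x).const_mul ((Real.Gamma ν)⁻¹ ^ 2)).congr (.of_forall fun y => ?_)
  simp only [ContinuousLinearMap.mul_apply', maternKernel_eq_dampedGamma hν hl]
  ring

open scoped Convolution
theorem mainTheorem5 (d : ℕ) (ν l : ℝ) (hν : 0 < ν) (hl : 0 < l) :
    MeasureTheory.ConvolutionExists (maternKernel d ν l) (maternKernel d ν l)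
      (ContinuousLinearMap.mul ℝ ℝ) MeasureTheory.volume ∧
    (∀ x : EuclideanSpace ℝ (Fin d), x ≠ 0 →
      (maternKernel d ν l ⋆[ContinuousLinearMap.mul ℝ ℝ, MeasureTheory.volume]
        maternKernel d ν l) x = maternConvFormula d ν l ‖x‖) ∧
    Filter.Tendsto (maternConvFormula d ν l) (nhdsWithin 0 (Set.Ioi 0))
      (nhds ((maternKernel d ν l ⋆[ContinuousLinearMap.mul ℝ ℝ, MeasureTheory.volume]
        maternKernel d ν l) 0)) := by
  refine ⟨convolutionExists_maternKernel d hν hl, fun x hx => ?_, ?_⟩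
  · rw [maternKernel_convolution_eq_dampedGamma hν hl,
      maternConvFormula_eq_dampedGamma hν hl (norm_pos_iff.2 hx)]
  · rw [maternKernel_convolution_eq_dampedGamma hν hl, norm_zero, zero_pow two_ne_zero, mul_zero]
    -- The damping parameter tends to `0` through nonnegative values, where the Gamma integrand
    -- dominates.
    have hq : Filter.Tendsto (fun r : ℝ => (√(2 * ν) / l) ^ 2 / 4 * r ^ 2)
        (nhdsWithin 0 (Ioi 0)) (nhdsWithin 0 (Ici 0)) := by
      refine tendsto_nhdsWithin_iff.2 ⟨?_, .of_forall fun r => mem_Ici.2 (by positivity)⟩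
      have hcont : Continuous fun r : ℝ => (√(2 * ν) / l) ^ 2 / 4 * r ^ 2 := by fun_prop
      simpa using (hcont.tendsto 0).mono_left nhdsWithin_le_nhds
    refine ((((tendsto_dampedGamma_zero (by positivity)).comp hq).const_mul _).const_mul _).congr'
      (eventually_mem_nhdsWithin.mono fun r hr => ?_)
    rw [maternConvFormula_eq_dampedGamma hν hl hr, Function.comp_apply]
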